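/- Let $K$ be any field, let $G$ be a group, and let $X$ be a set with a right action of $G$. Let $KG$ be the group algebra, and let $KX$ be the linear span of $X$, that is, the $K$-vector space with basis $X$, made into a right $KG$-module by extending the action of $G$ on $X$ bilinearly. The $G$-set $X$ is called amenable if there is a function $\mu$ from the set of all subsets of $X$ to $[0,1]$ such that $\mu(X)=1$, $\mu(A\sqcup B)=\mu(A)+\mu(B)$ for all disjoint $A,B\subseteq X$, and $\mu(Ag)=\mu(A)$ for all $A\subseteq X$ and $g\in G$. A right module $M$ over an associative $K$-algebra $R$ is called amenable if for every real $\varepsilon>0$ and every finite-dimensional subspace $S$ of $R$ there is a non-zero finite-dimensional subspace $F$ of $M$ such that $$\frac{\dim_K\big((F+Fs)/F\big)}{\dim_K F}<\varepsilon\qquad\text{for all } s\in S.$$ Then $X$ is amenable if and only if the right $KG$-module $KX$ is amenable. -/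

import Mathlib

open scoped RightActions

noncomputable section

/-- A right action of a group `G` on a set `X` (encoded as an action of `Gᵐᵒᵖ`, with `x <• g`
denoting the right translate) is amenable if `X` carries a `G`-invariant finitely additive
probability measure defined on all subsets. -/
def IsAmenableRightAction (G X : Type*) [Group G] [MulAction Gᵐᵒᵖ X] : Prop :=
  ∃ μ : Set X → ℝ,
    (∀ A, μ A ∈ Set.Icc (0 : ℝ) 1) ∧
    μ Set.univ = 1 ∧
    (∀ A B, Disjoint A B → μ (A ∪ B) = μ A + μ B) ∧
    (∀ (g : G) (A : Set X), μ ((fun x => x <• g) '' A) = μ A)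

section Translate

variable {K R M : Type*} [Field K] [Ring R] [Algebra K R] [AddCommGroup M] [Module K M]
  [Module Rᵐᵒᵖ M] [IsScalarTower K Rᵐᵒᵖ M]

/-- The right translate `F s = {m s | m ∈ F}` of a `K`-subspace `F` of a right `R`-module `M`. -/
def rightTranslate (F : Submodule K M) (s : R) : Submodule K M where
  carrier := {y | ∃ m ∈ F, y = m <• s}
  add_mem' := by
    rintro _ _ ⟨m, hm, rfl⟩ ⟨n, hn, rfl⟩
    exact ⟨m + n, F.add_mem hm hn, (smul_add _ _ _).symm⟩
  zero_mem' := ⟨0, F.zero_mem, (smul_zero _).symm⟩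
  smul_mem' := by
    rintro c _ ⟨m, hm, rfl⟩
    refine ⟨c • m, F.smul_mem c hm, ?_⟩
    rw [← algebraMap_smul Rᵐᵒᵖ c m, ← algebraMap_smul Rᵐᵒᵖ c (m <• s), smul_smul, smul_smul,
      Algebra.commutes]

end Translate

/-- Amenability of a right module `M` over an associative `K`-algebra `R`. The subspace `F` is
required to be nonzero, so that the quotient of dimensions is meaningful. -/
def IsAmenableRightModule (K R M : Type*) [Field K] [Ring R] [Algebra K R] [AddCommGroup M]
    [Module K M] [Module Rᵐᵒᵖ M] [IsScalarTower K Rᵐᵒᵖ M] : Prop :=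
  ∀ ε : ℝ, 0 < ε → ∀ S : Submodule K R, FiniteDimensional K S →
    ∃ F : Submodule K M, FiniteDimensional K F ∧ F ≠ ⊥ ∧
      ∀ s ∈ S,
        (Module.finrank K (↥(F ⊔ rightTranslate F s) ⧸ F.submoduleOf (F ⊔ rightTranslate F s)) : ℝ)
          / (Module.finrank K F : ℝ) < ε

section LinearSpan

variable (K G X : Type*) [Field K] [Group G] [MulAction Gᵐᵒᵖ X]

/-- The right action of `G` on the vector space `X →₀ K` with basis `X`, extending the action of
`G` on `X`. -/
def spanRightRep : G →* (Module.End K (X →₀ K))ᵐᵒᵖ where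
  toFun g := MulOpposite.op (Finsupp.lmapDomain K K (fun x : X => x <• g))
  map_one' := by
    apply MulOpposite.unop_injective
    ext x
    simp
  map_mul' g h := by
    apply MulOpposite.unop_injective
    ext x
    simp [mul_smul]

/-- The linear extension of the right action of `G` to the group algebra. -/
def spanRightAlgRep : MonoidAlgebra K G →ₐ[K] (Module.End K (X →₀ K))ᵐᵒᵖ :=
  MonoidAlgebra.lift K _ G (spanRightRep K G X)

variable {K G X}

/-- The linear span `KX` of a right `G`-set `X`, as a right module over the group algebra `KG`:
the vector space with basis `X`, with the bilinear extension of the action of `G` on `X`. -/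
instance spanRightModule : Module (MonoidAlgebra K G)ᵐᵒᵖ (X →₀ K) where
  smul r v := (spanRightAlgRep K G X r.unop).unop v
  one_smul v := by
    change (spanRightAlgRep K G X 1).unop v = v
    rw [map_one]; rfl
  mul_smul r s v := by
    change (spanRightAlgRep K G X (s.unop * r.unop)).unop v = _
    rw [map_mul]; rfl
  smul_zero r := map_zero (spanRightAlgRep K G X r.unop).unop
  smul_add r v w := map_add (spanRightAlgRep K G X r.unop).unop v w
  add_smul r s v := by
    change (spanRightAlgRep K G X (r.unop + s.unop)).unop v = _
    rw [map_add]; rfl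
  zero_smul v := by
    change (spanRightAlgRep K G X 0).unop v = 0
    rw [map_zero]; rfl

theorem span_smul_def (v : X →₀ K) (r : MonoidAlgebra K G) :
    v <• r = (spanRightAlgRep K G X r).unop v := rfl

instance spanRightScalarTower : IsScalarTower K (MonoidAlgebra K G)ᵐᵒᵖ (X →₀ K) where
  smul_assoc c r v := by
    change (spanRightAlgRep K G X (c • r.unop)).unop v = c • (spanRightAlgRep K G X r.unop).unop v
    rw [map_smul]; rfl

/-- The action on basis elements: `(a x)(b g) = (a b) (x g)`. -/
theorem span_single_smul_single (x : X) (a b : K) (g : G) :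
    Finsupp.single x a <• MonoidAlgebra.single g b = Finsupp.single (x <• g) (a * b) := by
  rw [span_smul_def]
  simp [spanRightAlgRep, spanRightRep, MonoidAlgebra.lift_single, mul_comm]

end LinearSpan

end

/-!
An invariant mean on `X` yields almost invariant finite sets `A ⊆ X` (Følner's criterion), and the
subspaces spanned by such sets are almost invariant. Følner's criterion is proved by contraposition
(`IsAmenableRightAction.exists_card_lt_two_mul`): otherwise some finite `T ⊆ G` satisfies
`|A T| ≥ 2 |A|` for all finite `A ⊆ X`, and Hall's marriage theorem gives two injections `X → X`
with disjoint images that move every point by an element of `T`. Each image has measure one, which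
is absurd.

Conversely, a finite-dimensional subspace `F` of `KX` has to be turned into a mean on `X`. Given an
ordering of a finite set `Y` that carries `F`, the pivots of `F` are the points where some vector of
`F` has its first nonzero coordinate. There are `dim F` of them (`card_isPivot`), and they grow with
`F`. The action of `G` does not respect the ordering, but the average over all orderings of the
number of pivots in a given set, `pivotMean`, is equivariant (`pivotMean_map`). So the pivot means of
`F` and of its translate `F g` both lie below that of `F + F g`, within `dim ((F + F g) / F)`. If `F`
is almost invariant, then so is its normalized pivot mean, and an ultrafilter limit of such means
is invariant.
-/

open Finset Filter Topology

/-! ### Linear algebra of finitely supported functions -/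

lemma exists_finset_le_supported {K α : Type*} [Field K] (F : Submodule K (α →₀ K))
    [FiniteDimensional K F] : ∃ Y : Finset α, F ≤ Finsupp.supported K K (Y : Set α) := by
  classical
  obtain ⟨s, hF⟩ := Submodule.fg_iff_finiteDimensional F |>.2 inferInstance
  refine ⟨s.biUnion Finsupp.support, ?_⟩
  rw [← hF, Submodule.span_le]
  intro v hv
  rw [SetLike.mem_coe, Finsupp.mem_supported]
  exact_mod_cast Finset.subset_biUnion_of_mem Finsupp.support hv

lemma exists_finset_forall_coeff_support_subset {K G : Type*} [Field K]
    (S : Submodule K (MonoidAlgebra K G))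
    [FiniteDimensional K S] : ∃ T : Finset G, ∀ s ∈ S, s.coeff.support ⊆ T := by
  obtain ⟨T, hT⟩ := exists_finset_le_supported
    (S.map (MonoidAlgebra.coeffLinearEquiv K).toLinearMap)
  refine ⟨T, fun s hs => ?_⟩
  exact_mod_cast (Finsupp.mem_supported K _).1 (hT (Submodule.mem_map_of_mem hs))

lemma finrank_supported {K α : Type*} [Field K] (Y : Finset α) :
    Module.finrank K (Finsupp.supported K K (Y : Set α)) = #Y := by
  rw [(Finsupp.supportedEquivFinsupp (M := K) (R := K) (Y : Set α)).finrank_eq]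
  simp

instance {K α : Type*} [Field K] (Y : Finset α) :
    FiniteDimensional K (Finsupp.supported K K (Y : Set α)) :=
  Module.Finite.equiv (Finsupp.supportedEquivFinsupp (M := K) (R := K) (Y : Set α)).symm

lemma finrank_quotient_submoduleOf {K V : Type*} [Field K] [AddCommGroup V] [Module K V]
    {E F : Submodule K V} (h : F ≤ E) [FiniteDimensional K E] :
    Module.finrank K (E ⧸ F.submoduleOf E) + Module.finrank K F = Module.finrank K E := by
  rw [← Submodule.finrank_quotient_add_finrank (F.submoduleOf E),
    (Submodule.submoduleOfEquivOfLe h).finrank_eq]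

/-! ### Pivot positions of a subspace -/

section Pivot

variable {K X : Type*} [Field K]

/-- Given an enumeration `f` of points of `X`, the index `i` is a pivot of the subspace `F` of `KX`
if `f i` is the first point in the enumeration at which some vector of `F` does not vanish. -/
def IsPivot (F : Submodule K (X →₀ K)) {n : ℕ} (f : Fin n → X) (i : Fin n) : Prop :=
  ∃ v ∈ F, v (f i) ≠ 0 ∧ ∀ j < i, v (f j) = 0

lemma IsPivot.mono {F E : Submodule K (X →₀ K)} (h : F ≤ E) {n : ℕ} {f : Fin n → X} {i : Fin n}
    (hi : IsPivot F f i) : IsPivot E f i :=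
  let ⟨v, hv, hvi⟩ := hi
  ⟨v, h hv, hvi⟩

open Classical in
lemma finrank_eq_add_finrank_inf_ker {V : Type*} [AddCommGroup V] [Module K V]
    (F : Submodule K V) [FiniteDimensional K F] (φ : V →ₗ[K] K) :
    Module.finrank K F =
      (if ∃ v ∈ F, φ v ≠ 0 then 1 else 0) + Module.finrank K ↥(F ⊓ LinearMap.ker φ) := by
  have hker : Module.finrank K (LinearMap.ker (φ.domRestrict F)) =
      Module.finrank K ↥(F ⊓ LinearMap.ker φ) := by
    have : (LinearMap.ker (φ.domRestrict F)) = (F ⊓ LinearMap.ker φ).submoduleOf F := by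
      ext v; simp [Submodule.submoduleOf]
    rw [this, (Submodule.submoduleOfEquivOfLe inf_le_left).finrank_eq]
  rw [← LinearMap.finrank_range_add_finrank_ker (φ.domRestrict F), hker]
  congr 1
  split_ifs with h
  · obtain ⟨v, hv, hφ⟩ := h
    have : LinearMap.range (φ.domRestrict F) = ⊤ :=
      LinearMap.range_eq_top.2 (LinearMap.surjective fun h0 => hφ (by
        simpa using LinearMap.congr_fun h0 ⟨v, hv⟩))
    rw [this, finrank_top, Module.finrank_self]
  · push Not at h
    have : φ.domRestrict F = 0 := by ext v; simpa using h v v.2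
    rw [this, LinearMap.range_zero, finrank_bot]

open Classical in
/-- Gaussian elimination: if the points enumerated by `f` detect the vectors of `F`, the number of
pivots of `F` is its dimension. -/
lemma card_isPivot {n : ℕ} (f : Fin n → X) (F : Submodule K (X →₀ K)) [FiniteDimensional K F]
    (hF : ∀ v ∈ F, (∀ i, v (f i) = 0) → v = 0) :
    #{i | IsPivot F f i} = Module.finrank K F := by
  induction n generalizing F with
  | zero =>
    have : F = ⊥ := (Submodule.eq_bot_iff F).2 fun v hv => hF v hv fun i => i.elim0
    subst this
    simp
  | succ n ih =>
    have hfd : FiniteDimensional K ↥(F ⊓ LinearMap.ker (Finsupp.lapply (R := K) (M := K) (f 0))) :=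
      Submodule.finiteDimensional_of_le (inf_le_left : _ ≤ F)
    rw [finrank_eq_add_finrank_inf_ker F (Finsupp.lapply (f 0)),
      ← ih (fun i => f i.succ) (F ⊓ LinearMap.ker (Finsupp.lapply (f 0))) ?_]
    · simp only [Finset.card_filter]
      rw [Fin.sum_univ_succ]
      congr 1
      · exact if_congr (by simp [IsPivot]) rfl rfl
      · refine Finset.sum_congr rfl fun i _ => if_congr ?_ rfl rfl
        simp only [IsPivot, Fin.forall_fin_succ, Submodule.mem_inf, LinearMap.mem_ker,
          Finsupp.lapply_apply, Fin.succ_lt_succ_iff, Fin.succ_pos, forall_const]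
        exact exists_congr fun v => by tauto
    · rintro v ⟨hv, hv0⟩ h
      exact hF v hv (Fin.forall_fin_succ.2 ⟨hv0, h⟩)

open Classical in
/-- The average, over all enumerations of the finite set `Y`, of the number of pivots of `F` that
lie in `A`. -/
noncomputable def pivotMean (F : Submodule K (X →₀ K)) (Y : Finset X) (A : Set X) : ℝ :=
  Finset.univ.expect fun e : Fin (#Y) ≃ Y =>
    (#{i | IsPivot F (fun j => (e j : X)) i ∧ (e i : X) ∈ A} : ℝ)

lemma pivotMean_nonneg (F : Submodule K (X →₀ K)) (Y : Finset X) (A : Set X) :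
    0 ≤ pivotMean F Y A :=
  Finset.expect_nonneg fun _ _ => Nat.cast_nonneg _

lemma pivotMean_union (F : Submodule K (X →₀ K)) (Y : Finset X) {A B : Set X}
    (h : Disjoint A B) : pivotMean F Y (A ∪ B) = pivotMean F Y A + pivotMean F Y B := by
  classical
  rw [pivotMean, pivotMean, pivotMean, ← Finset.expect_add_distrib]
  refine Finset.expect_congr rfl fun e _ => ?_
  norm_cast
  rw [← Finset.card_union_of_disjoint]
  · congr 1
    ext i
    simp [and_or_left]
  · rw [Finset.disjoint_filter]
    rintro i - ⟨-, hA⟩ ⟨-, hB⟩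
    exact Set.disjoint_left.1 h hA hB

lemma pivotMean_mono {E F : Submodule K (X →₀ K)} (h : F ≤ E) (Y : Finset X) (A : Set X) :
    pivotMean F Y A ≤ pivotMean E Y A := by
  classical
  refine Finset.expect_le_expect fun e _ => ?_
  norm_cast
  exact Finset.card_le_card
    (Finset.monotone_filter_right _ fun i _ hi => ⟨hi.1.mono h, hi.2⟩)

lemma pivotMean_univ (F : Submodule K (X →₀ K)) [FiniteDimensional K F] {Y : Finset X}
    (hF : F ≤ Finsupp.supported K K (Y : Set X)) :
    pivotMean F Y Set.univ = Module.finrank K F := by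
  classical
  have : Nonempty (Fin (#Y) ≃ Y) := ⟨Y.equivFin.symm⟩
  rw [pivotMean, Finset.expect_congr rfl (g := fun _ => (Module.finrank K F : ℝ)),
    Fintype.expect_const]
  intro e _
  simp only [Set.mem_univ, and_true]
  rw [card_isPivot]
  intro v hv h
  ext x
  by_cases hx : x ∈ Y
  · obtain ⟨i, hi⟩ := e.surjective ⟨x, hx⟩
    simpa [hi] using h i
  · exact (Finsupp.mem_supported' K v).1 (hF hv) x hx

/-- Enlarging `F` changes the mean of a set by at most the increase of the dimension. -/
lemma pivotMean_le_add {E F : Submodule K (X →₀ K)} [FiniteDimensional K E]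
    (h : F ≤ E) {Y : Finset X} (hE : E ≤ Finsupp.supported K K (Y : Set X)) (A : Set X) :
    pivotMean E Y A ≤ pivotMean F Y A + (Module.finrank K E - Module.finrank K F) := by
  have : FiniteDimensional K F := Submodule.finiteDimensional_of_le h
  have h1 := pivotMean_union F Y (disjoint_compl_right (a := A))
  have h2 := pivotMean_union E Y (disjoint_compl_right (a := A))
  rw [Set.union_compl_self, pivotMean_univ _ (h.trans hE)] at h1
  rw [Set.union_compl_self, pivotMean_univ _ hE] at h2
  have := pivotMean_mono h Y Aᶜ
  linarith

/-- The pivot mean is equivariant under permutations of `X`. The permutation need not preserve `Y`,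
as long as `Y` carries both `F` and its image. -/
lemma pivotMean_map (σ : Equiv.Perm X) (F : Submodule K (X →₀ K)) {Y : Finset X}
    (hF : F ≤ Finsupp.supported K K (Y : Set X))
    (hσF : F.map (Finsupp.lmapDomain K K σ) ≤ Finsupp.supported K K (Y : Set X)) (A : Set X) :
    pivotMean (F.map (Finsupp.lmapDomain K K σ)) Y (σ '' A) = pivotMean F Y A := by
  classical
  have hmap : ∀ (v : X →₀ K) x, Finsupp.lmapDomain K K σ v (σ x) = v x := fun v x =>
    Finsupp.mapDomain_apply σ.injective v x
  -- On the points where `F` lives, `σ` agrees with a permutation `τ` of `Y`.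
  let s : Set Y := {y | ∃ v ∈ F, v y ≠ 0}
  obtain ⟨τ, hτ⟩ : ∃ τ : Y ≃ Y, ∀ y ∈ s, (τ y : X) = σ y := by
    refine Set.MapsTo.exists_equiv_extend_of_card_eq (f := fun y : Y => σ y) (by simp) ?_
      (fun a _ b _ hab => Subtype.ext (σ.injective hab))
    rintro y ⟨v, hv, hvy⟩
    by_contra hy
    have := (Finsupp.mem_supported' K _).1 (hσF (Submodule.mem_map_of_mem hv)) (σ y) hy
    exact hvy (by rwa [hmap] at this)
  have key : ∀ v ∈ F, ∀ y : Y, Finsupp.lmapDomain K K σ v (τ y) = v y := by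
    intro v hv y
    by_cases hy : y ∈ s
    · rw [hτ y hy, hmap]
    · have hvy : v y = 0 := by
        by_contra h
        exact hy ⟨v, hv, h⟩
      obtain ⟨x, hx⟩ := σ.surjective (τ y : X)
      rw [hvy, ← hx, hmap]
      by_contra hvx
      have hxY : x ∈ Y := by
        by_contra h
        exact hvx ((Finsupp.mem_supported' K v).1 (hF hv) x h)
      have hxs : (⟨x, hxY⟩ : Y) ∈ s := ⟨v, hv, hvx⟩
      have : τ ⟨x, hxY⟩ = τ y := Subtype.ext (by rw [hτ _ hxs, hx])
      exact hvx (by rw [← hvy, ← τ.injective this])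
  symm
  refine Fintype.expect_equiv (Equiv.equivCongr (Equiv.refl _) τ) _ _ fun e => ?_
  rw [Nat.cast_inj]
  refine congrArg Finset.card (Finset.filter_congr fun i _ => ?_)
  have hpiv : IsPivot (F.map (Finsupp.lmapDomain K K σ)) (fun j => (τ (e j) : X)) i ↔
      IsPivot F (fun j => (e j : X)) i := by
    constructor
    · rintro ⟨_, ⟨v, hv, rfl⟩, h0, h1⟩
      refine ⟨v, hv, by rwa [key v hv] at h0, fun j hj => ?_⟩
      have := h1 j hj
      rwa [key v hv] at this
    · rintro ⟨v, hv, h0, h1⟩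
      refine ⟨_, Submodule.mem_map_of_mem hv, by rwa [key v hv], fun j hj => ?_⟩
      rw [key v hv]
      exact h1 j hj
  simp only [Equiv.equivCongr_apply_apply, Equiv.refl_symm, Equiv.refl_apply]
  rw [hpiv]
  refine and_congr_right fun hi => ?_
  obtain ⟨v, hv, hvi, -⟩ := hi
  rw [hτ (e i) ⟨v, hv, hvi⟩, σ.injective.mem_set_image]

end Pivot

/-! ### From almost invariant means to an invariant mean -/

section Mean

variable {G X : Type*} [Group G] [MulAction Gᵐᵒᵖ X]

/-- An ultrafilter limit of finitely additive probability measures that are more and more invariant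
is an invariant one. -/
lemma isAmenableRightAction_of_almost_invariant
    (h : ∀ (T : Finset G) (ε : ℝ), 0 < ε → ∃ m : Set X → ℝ, (∀ A, 0 ≤ m A) ∧ m Set.univ = 1 ∧
      (∀ A B, Disjoint A B → m (A ∪ B) = m A + m B) ∧
      ∀ g ∈ T, ∀ A : Set X, |m ((fun x => x <• g) '' A) - m A| ≤ ε) :
    IsAmenableRightAction G X := by
  classical
  choose m h0 h1 hadd hinv using fun p : Finset G × ℕ =>
    h p.1 (1 / ((p.2 : ℝ) + 1)) (by positivity)
  have hIcc : ∀ p A, m p A ∈ Set.Icc (0 : ℝ) 1 := by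
    intro p A
    have := hadd p A Aᶜ disjoint_compl_right
    rw [Set.union_compl_self, h1] at this
    exact ⟨h0 p A, by linarith [h0 p Aᶜ]⟩
  let U : Ultrafilter (Finset G × ℕ) := Ultrafilter.of atTop
  have hU : (U : Filter (Finset G × ℕ)) ≤ atTop := Ultrafilter.of_le atTop
  obtain ⟨μ, hμ, hlim⟩ := (isCompact_univ_pi fun _ : Set X =>
    isCompact_Icc (a := (0 : ℝ)) (b := 1)).ultrafilter_le_nhds (U.map m)
      (by
        rw [Ultrafilter.coe_map, Filter.le_principal_iff]
        exact Filter.mem_map.2 (Filter.univ_mem' fun p A _ => hIcc p A))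
  have htend : ∀ A, Tendsto (fun p => m p A) U (𝓝 (μ A)) := tendsto_pi_nhds.1 hlim
  refine ⟨μ, fun A => hμ A trivial, ?_, fun A B hAB => ?_, fun g A => ?_⟩
  · exact tendsto_nhds_unique (htend _) (by simp [h1])
  · refine tendsto_nhds_unique (htend _) ?_
    simp_rw [hadd _ A B hAB]
    exact (htend A).add (htend B)
  · have h2 : Tendsto (fun p : Finset G × ℕ => 1 / ((p.2 : ℝ) + 1)) U (𝓝 0) :=
      ((tendsto_one_div_add_atTop_nhds_zero_nat (𝕜 := ℝ)).comp
        (tendsto_snd.mono_left (prod_atTop_atTop_eq (α := Finset G) (β := ℕ)).ge)).mono_left hU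
    have h3 : ∀ᶠ p in (U : Filter (Finset G × ℕ)),
        |m p ((fun x => x <• g) '' A) - m p A| ≤ 1 / ((p.2 : ℝ) + 1) := by
      filter_upwards [hU (Ici_mem_atTop (({g}, 0) : Finset G × ℕ))] with p hp
      exact hinv p g (Finset.singleton_subset_iff.1 hp.1) A
    have h4 := squeeze_zero_norm' (f := fun p => m p ((fun x => x <• g) '' A) - m p A) h3 h2
    exact sub_eq_zero.1 (tendsto_nhds_unique ((htend _).sub (htend A)) h4)

end Mean

/-! ### Almost invariant finite sets -/

section Folner

variable {G X : Type*} [Group G] [MulAction Gᵐᵒᵖ X]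

open Classical in
/-- The finite set `A T = {x g | x ∈ A, g ∈ T}`. -/
noncomputable def rightProduct (A : Finset X) (T : Finset G) : Finset X :=
  Finset.image₂ (fun x g => x <• g) A T

lemma mem_rightProduct {A : Finset X} {T : Finset G} {y : X} :
    y ∈ rightProduct A T ↔ ∃ x ∈ A, ∃ g ∈ T, x <• g = y := by
  simp [rightProduct]

open Classical in
lemma exists_pow_mul_card_le {T : Finset G} {c : ℝ} (hc : 0 ≤ c)
    (h : ∀ A : Finset X, c * #A ≤ #(rightProduct A T)) (n : ℕ) :
    ∃ T' : Finset G, ∀ A : Finset X, c ^ n * #A ≤ #(rightProduct A T') := by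
  induction n with
  | zero => exact ⟨{1}, fun A => by simp [rightProduct]⟩
  | succ n ih =>
    obtain ⟨T', hT'⟩ := ih
    refine ⟨Finset.image₂ (· * ·) T' T, fun A => ?_⟩
    have : rightProduct A (Finset.image₂ (· * ·) T' T) = rightProduct (rightProduct A T') T := by
      rw [rightProduct, rightProduct, rightProduct]
      exact (Finset.image₂_assoc fun x g k => by simp [mul_smul]).symm
    rw [this]
    calc c ^ (n + 1) * #A = c * (c ^ n * #A) := by ring
      _ ≤ c * #(rightProduct A T') := by gcongr; exact hT' A
      _ ≤ _ := h _

lemma map_biUnion_finset_eq_sum {μ : Set X → ℝ}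
    (hadd : ∀ A B, Disjoint A B → μ (A ∪ B) = μ A + μ B) {ι : Type*} (s : Finset ι)
    (A : ι → Set X) (hA : Pairwise fun i j => Disjoint (A i) (A j)) :
    μ (⋃ i ∈ s, A i) = ∑ i ∈ s, μ (A i) := by
  classical
  induction s using Finset.induction_on with
  | empty =>
    have := hadd ∅ ∅ (by simp)
    simp only [Set.union_empty] at this
    simpa using this
  | insert i s hi ih =>
    rw [Finset.set_biUnion_insert, Finset.sum_insert hi, hadd, ih]
    simp only [Set.disjoint_iUnion_right]
    exact fun j hj => hA fun hij => hi (hij ▸ hj)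

/-- An injection that moves every point by an element of a fixed finite subset of `G` preserves an
invariant mean. -/
lemma map_range_piecewise_translation {μ : Set X → ℝ} (h1 : μ Set.univ = 1)
    (hadd : ∀ A B, Disjoint A B → μ (A ∪ B) = μ A + μ B)
    (hinv : ∀ (g : G) (A : Set X), μ ((fun x => x <• g) '' A) = μ A)
    {T : Finset G} {φ : X → X} (hφ : Function.Injective φ) (γ : X → G) (hγ : ∀ x, γ x ∈ T)
    (hφγ : ∀ x, x <• γ x = φ x) : μ (Set.range φ) = 1 := by
  have himg : ∀ g, (fun x => x <• g) '' {x | γ x = g} = φ '' {x | γ x = g} := fun g =>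
    Set.image_congr fun x hx => by
      obtain rfl : γ x = g := hx
      exact hφγ x
  have hdisj : Pairwise fun g k => Disjoint {x | γ x = g} {x | γ x = k} := fun g k hgk =>
    Set.disjoint_left.2 fun x hx hx' => hgk (Eq.trans (Eq.symm hx) hx')
  have hrange : Set.range φ = ⋃ g ∈ T, φ '' {x | γ x = g} := by
    ext y
    simp only [Set.mem_range, Set.mem_iUnion, Set.mem_image, Set.mem_ofPred_eq, exists_prop]
    constructor
    · rintro ⟨x, rfl⟩
      exact ⟨γ x, hγ x, x, rfl, rfl⟩
    · rintro ⟨_, _, x, _, rfl⟩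
      exact ⟨x, rfl⟩
  have huniv : (Set.univ : Set X) = ⋃ g ∈ T, {x | γ x = g} := by
    ext x
    simpa using hγ x
  rw [hrange, map_biUnion_finset_eq_sum hadd T _ fun g k hgk =>
    (Set.disjoint_image_iff hφ).2 (hdisj hgk), ← h1, huniv,
    map_biUnion_finset_eq_sum hadd T _ hdisj]
  exact Finset.sum_congr rfl fun g _ => by rw [← himg, hinv]

open Classical in
/-- If right multiplication by `T` at least doubled every finite set, Hall's theorem would provide
two injections of `X` into itself with disjoint images, both translating points by elements of `T`
only; their images would be disjoint sets of measure one. -/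
lemma IsAmenableRightAction.exists_card_lt_two_mul (h : IsAmenableRightAction G X)
    (T : Finset G) : ∃ A : Finset X, #(rightProduct A T) < 2 * #A := by
  by_contra! hT
  obtain ⟨μ, h01, h1, hadd, hinv⟩ := h
  obtain ⟨φ, hφ, hφT⟩ := (Finset.all_card_le_biUnion_card_iff_exists_injective
    fun p : X × Bool => rightProduct {p.1} T).1 (by
      intro s
      calc #s ≤ #(s.image Prod.fst ×ˢ (Finset.univ : Finset Bool)) :=
            Finset.card_le_card fun p hp =>
              Finset.mem_product.2 ⟨Finset.mem_image_of_mem _ hp, Finset.mem_univ _⟩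
        _ = 2 * #(s.image Prod.fst) := by rw [Finset.card_product, mul_comm]; rfl
        _ ≤ #(rightProduct (s.image Prod.fst) T) := hT _
        _ ≤ _ := Finset.card_le_card fun y hy => by
            obtain ⟨x, hx, g, hg, rfl⟩ := mem_rightProduct.1 hy
            obtain ⟨p, hp, rfl⟩ := Finset.mem_image.1 hx
            exact Finset.mem_biUnion.2 ⟨p, hp, mem_rightProduct.2
              ⟨p.1, Finset.mem_singleton_self _, g, hg, rfl⟩⟩)
  have hγ : ∀ p : X × Bool, ∃ g ∈ T, p.1 <• g = φ p := fun p => by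
    simpa [mem_rightProduct] using hφT p
  choose γ hγT hγφ using hγ
  have hrange : ∀ b, μ (Set.range fun x => φ (x, b)) = 1 := fun b =>
    map_range_piecewise_translation h1 hadd hinv (T := T)
      (fun x y hxy => congrArg Prod.fst (hφ hxy)) (fun x => γ (x, b)) (fun x => hγT _)
      fun x => hγφ _
  have hdisj : Disjoint (Set.range fun x => φ (x, true)) (Set.range fun x => φ (x, false)) := by
    rw [Set.disjoint_left]
    rintro _ ⟨x, rfl⟩ ⟨y, hy⟩
    exact Bool.false_ne_true (congrArg Prod.snd (hφ hy))
  have := (h01 ((Set.range fun x => φ (x, true)) ∪ Set.range fun x => φ (x, false))).2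
  rw [hadd _ _ hdisj, hrange, hrange] at this
  norm_num at this

/-- Følner's criterion. -/
lemma IsAmenableRightAction.exists_card_lt (h : IsAmenableRightAction G X)
    (T : Finset G) {ε : ℝ} (hε : 0 < ε) :
    ∃ A : Finset X, (#(rightProduct A T) : ℝ) < (1 + ε) * #A := by
  by_contra! hT
  obtain ⟨n, hn⟩ := pow_unbounded_of_one_lt 2 (by linarith : 1 < 1 + ε)
  obtain ⟨T', hT'⟩ := exists_pow_mul_card_le (by positivity) hT n
  obtain ⟨A, hA⟩ := h.exists_card_lt_two_mul T'
  have hA' : (#(rightProduct A T') : ℝ) < 2 * #A := by exact_mod_cast hA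
  exact absurd ((hT' A).trans_lt hA') (not_lt.2 (by gcongr))

end Folner

/-! ### Translates in the linear span of a `G`-set -/

section Span

variable {K G X : Type*} [Field K] [Group G] [MulAction Gᵐᵒᵖ X]

lemma span_smul_eq_sum (v : X →₀ K) (r : MonoidAlgebra K G) :
    v <• r = ∑ g ∈ r.coeff.support, r.coeff g • Finsupp.mapDomain (fun x : X => x <• g) v := by
  rw [span_smul_def, spanRightAlgRep, MonoidAlgebra.lift_apply, Finsupp.sum]
  simp [spanRightRep, Finset.unop_sum, LinearMap.sum_apply]

lemma rightTranslate_single_one (F : Submodule K (X →₀ K)) (g : G) :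
    rightTranslate F (MonoidAlgebra.single g (1 : K)) =
      F.map (Finsupp.lmapDomain K K (MulAction.toPerm (MulOpposite.op g) : Equiv.Perm X)) := by
  have h : ∀ v : X →₀ K, v <• MonoidAlgebra.single g (1 : K) =
      Finsupp.lmapDomain K K (MulAction.toPerm (MulOpposite.op g) : Equiv.Perm X) v := fun v => by
    rw [span_smul_def, spanRightAlgRep, MonoidAlgebra.lift_single, one_smul]
    rfl
  ext y
  constructor
  · rintro ⟨v, hv, rfl⟩
    exact ⟨v, hv, (h v).symm⟩
  · rintro ⟨v, hv, rfl⟩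
    exact ⟨v, hv, (h v).symm⟩

lemma rightTranslate_supported_le {A : Finset X} {T : Finset G} {r : MonoidAlgebra K G}
    (hr : r.coeff.support ⊆ T) :
    rightTranslate (Finsupp.supported K K (A : Set X)) r ≤
      Finsupp.supported K K (rightProduct A T : Set X) := by
  classical
  rintro _ ⟨v, hv, rfl⟩
  rw [span_smul_eq_sum]
  refine Submodule.sum_mem _ fun g hg => Submodule.smul_mem _ _ ?_
  rw [Finsupp.mem_supported]
  intro y hy
  obtain ⟨x, hx, rfl⟩ := Finset.mem_image.1 (Finsupp.mapDomain_support hy)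
  exact mem_rightProduct.2 ⟨x, (Finsupp.mem_supported K v).1 hv hx, g, hr hg, rfl⟩

end Span

/-! ### The two implications -/

section Main

variable {K G X : Type*} [Field K] [Group G] [MulAction Gᵐᵒᵖ X]

lemma IsAmenableRightAction.isAmenableRightModule (h : IsAmenableRightAction G X) :
    IsAmenableRightModule K (MonoidAlgebra K G) (X →₀ K) := by
  classical
  intro ε hε S hS
  obtain ⟨T, hT⟩ := exists_finset_forall_coeff_support_subset S
  -- With `1 ∈ T`, the set `A T` contains `A`.
  obtain ⟨A, hA⟩ := h.exists_card_lt (insert 1 T) hε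
  have hA0 : 0 < #A := Nat.pos_of_ne_zero fun h0 => by
    rw [h0] at hA
    simp only [Nat.cast_zero, mul_zero] at hA
    exact absurd hA (not_lt.2 (Nat.cast_nonneg _))
  refine ⟨Finsupp.supported K K (A : Set X), inferInstance, fun hbot => ?_, fun s hs => ?_⟩
  · have := finrank_supported (K := K) A
    rw [hbot, finrank_bot] at this
    omega
  · have hle : Finsupp.supported K K (A : Set X) ⊔
        rightTranslate (Finsupp.supported K K (A : Set X)) s ≤
        Finsupp.supported K K (rightProduct A (insert 1 T) : Set X) :=
      sup_le (Finsupp.supported_mono fun x hx => mem_rightProduct.2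
          ⟨x, hx, 1, Finset.mem_insert_self _ _, by simp⟩)
        (rightTranslate_supported_le ((hT s hs).trans (Finset.subset_insert _ _)))
    have := Submodule.finiteDimensional_of_le hle
    have h1 := finrank_quotient_submoduleOf (K := K)
      (le_sup_left : Finsupp.supported K K (A : Set X) ≤ Finsupp.supported K K (A : Set X) ⊔
        rightTranslate (Finsupp.supported K K (A : Set X)) s)
    have h2 := Submodule.finrank_mono hle
    rw [finrank_supported] at h1 h2
    rw [← h1] at h2
    have h3 := (Nat.cast_le (α := ℝ)).2 h2
    push_cast at h3
    rw [finrank_supported, div_lt_iff₀ (by exact_mod_cast hA0)]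
    linarith

/-- For an almost invariant subspace `F`, the normalized pivot mean of `F` is an almost invariant
finitely additive probability measure. -/
lemma IsAmenableRightModule.isAmenableRightAction
    (h : IsAmenableRightModule K (MonoidAlgebra K G) (X →₀ K)) : IsAmenableRightAction G X := by
  classical
  refine isAmenableRightAction_of_almost_invariant fun T ε hε => ?_
  obtain ⟨F, hFfd, hF0, hF⟩ := h ε hε
    (Submodule.span K (T.image fun g => MonoidAlgebra.single g (1 : K) :
      Finset (MonoidAlgebra K G))) (FiniteDimensional.span_finset K _)
  have hpos : (0 : ℝ) < Module.finrank K F := by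
    exact_mod_cast Nat.pos_of_ne_zero fun h0 => hF0 (Submodule.finrank_eq_zero.1 h0)
  obtain ⟨Y₀, hY₀⟩ := exists_finset_le_supported F
  -- A finite set that carries `F` and all its translates by elements of `T`.
  let Y := rightProduct Y₀ (insert 1 T)
  have hFY : F ≤ Finsupp.supported K K (Y : Set X) :=
    hY₀.trans (Finsupp.supported_mono fun x hx => mem_rightProduct.2
      ⟨x, hx, 1, Finset.mem_insert_self _ _, by simp⟩)
  refine ⟨fun A => pivotMean F Y A / Module.finrank K F,
    fun A => div_nonneg (pivotMean_nonneg _ _ _) hpos.le,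
    by simp only [pivotMean_univ F hFY, div_self hpos.ne'],
    fun A B hAB => by simp only [pivotMean_union F Y hAB, add_div], fun g hg A => ?_⟩
  set s : MonoidAlgebra K G := MonoidAlgebra.single g 1 with hs
  have hFs := hF s (Submodule.subset_span (by
    exact_mod_cast Finset.mem_image_of_mem (fun g => MonoidAlgebra.single g (1 : K)) hg))
  have hsY : rightTranslate F s ≤ Finsupp.supported K K (Y : Set X) := by
    refine le_trans ?_ (rightTranslate_supported_le (A := Y₀) (T := insert 1 T) (r := s) ?_)
    · rintro _ ⟨v, hv, rfl⟩
      exact ⟨v, hY₀ hv, rfl⟩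
    · rw [hs, MonoidAlgebra.coeff_single]
      exact Finsupp.support_single_subset.trans
        (Finset.singleton_subset_iff.2 (Finset.mem_insert_of_mem hg))
  have hEY := sup_le hFY hsY
  have hEfd := Submodule.finiteDimensional_of_le hEY
  have htr := rightTranslate_single_one F g
  have himg : ∀ B : Set X, pivotMean (rightTranslate F s) Y ((fun x => x <• g) '' B) =
      pivotMean F Y B := fun B => by
    rw [hs, htr]
    exact pivotMean_map (MulAction.toPerm (MulOpposite.op g)) F hFY (htr ▸ hsY) B
  have hrank : Module.finrank K (rightTranslate F s) = Module.finrank K F := by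
    rw [hs, htr]
    exact (LinearEquiv.finrank_eq (Submodule.equivMapOfInjective _
      (Finsupp.mapDomain_injective (Equiv.injective _)) F)).symm
  have hquot := finrank_quotient_submoduleOf (le_sup_left : F ≤ F ⊔ rightTranslate F s)
  have hquot' := congrArg (Nat.cast (R := ℝ)) hquot
  push_cast at hquot'
  rw [div_lt_iff₀ hpos] at hFs
  -- Both means are at most the one of `F + F s`, and differ from it by at most `dim ((F + F s) / F)`.
  have h1 := pivotMean_mono (le_sup_left : F ≤ F ⊔ rightTranslate F s) Y ((fun x => x <• g) '' A)
  have h2 := pivotMean_mono (le_sup_right : rightTranslate F s ≤ F ⊔ rightTranslate F s) Y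
    ((fun x => x <• g) '' A)
  have h3 := pivotMean_le_add (le_sup_left : F ≤ F ⊔ rightTranslate F s) hEY
    ((fun x => x <• g) '' A)
  have h4 := pivotMean_le_add (le_sup_right : rightTranslate F s ≤ F ⊔ rightTranslate F s) hEY
    ((fun x => x <• g) '' A)
  rw [himg] at h2 h4
  rw [hrank] at h4
  rw [← sub_div, abs_div, abs_of_pos hpos, div_le_iff₀ hpos, abs_le]
  constructor <;> linarith

end Main

theorem theorem1 (K G X : Type*) [Field K] [Group G] [MulAction Gᵐᵒᵖ X] :
    IsAmenableRightAction G X ↔ IsAmenableRightModule K (MonoidAlgebra K G) (X →₀ K) :=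
  ⟨fun h => h.isAmenableRightModule, fun h => h.isAmenableRightAction⟩
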